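/- Let $\mathcal H$ be a separable complex Hilbert space, and let $H$ be a (possibly unbounded, possibly continuous-spectrum) self-adjoint operator on $\mathcal H$ which is not the zero operator. Let $T:\mathcal H\to\mathcal H$ be an antiunitary bijection (an antilinear isometric bijection) such that $T^2=-I$ and such that $T$ commutes with $H$, that is, $T$ maps the domain $D(H)$ into itself and $HT\psi=TH\psi$ for all $\psi\in D(H)$. Let $\{H\}'$ be the commutant of $H$: the set of all bounded linear operators $B$ on $\mathcal H$ commuting with $H$, i.e. with $B\,D(H)\subseteq D(H)$ and $HB\psi=BH\psi$ for all $\psi\in D(H)$. Let $\{H\}''$ be the double commutant of $H$: the set of all closed densely defined linear operators $C$ on $\mathcal H$ that commute with every $B\in\{H\}'$, i.e. with $B\,D(C)\subseteq D(C)$ and $CB\psi=BC\psi$ for all $\psi\in D(C)$. Then $$\{H\}'\neq\{H\}''.$$ Moreover, the two sets already differ among bounded operators: if $\mathcal B(\mathcal H)$ denotes the bounded linear operators on $\mathcal H$, then $$\{H\}'\neq\{H\}''\cap\mathcal B(\mathcal H).$$ -/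

import Mathlib

namespace Kramers

variable {E : Type*} [NormedAddCommGroup E] [InnerProductSpace ℂ E]

/-- An everywhere defined map `S` (linear or antilinear) commutes with the possibly unbounded
operator `A`, i.e. `S A ⊆ A S`: `S` maps the domain of `A` into itself, and there
`A (S x) = S (A x)`. -/
def CommutesWith (S : E → E) (A : E →ₗ.[ℂ] E) : Prop :=
  ∀ x : A.domain, ∃ h : S x ∈ A.domain, A ⟨S x, h⟩ = S (A x)

/-- The commutant of `A`: all bounded (everywhere defined) linear operators commuting
with `A`. -/
def commutant (A : E →ₗ.[ℂ] E) : Set (E →L[ℂ] E) :=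
  {B | CommutesWith B A}

/-- A bounded operator, regarded as a partially defined operator whose domain is the whole
space. -/
def ofBounded (B : E →L[ℂ] E) : E →ₗ.[ℂ] E :=
  (B : E →ₗ[ℂ] E).toPMap ⊤

/-- The double commutant of `A`: all closed (densely defined, possibly unbounded) linear
operators commuting with every element of the commutant of `A`. -/
def doubleCommutant (A : E →ₗ.[ℂ] E) : Set (E →ₗ.[ℂ] E) :=
  {C | Dense (C.domain : Set E) ∧ C.IsClosed ∧ ∀ B ∈ commutant A, CommutesWith B C}

/-- The bounded double commutant of `A`: the bounded operators which belong to the double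
commutant of `A`. -/
def boundedDoubleCommutant (A : E →ₗ.[ℂ] E) : Set (E →L[ℂ] E) :=
  {C | ofBounded C ∈ doubleCommutant A}

end Kramers

/-!
The commutant of `H` is not abelian, whereas every bounded element of the double commutant
commutes with the whole commutant.

Since `T` is antilinear and commutes with `H`, it intertwines the resolvent `R = (H - i)⁻¹` with
`R* = (H + i)⁻¹`. As `R` is normal, `T B = B* T` for every `B` in the `*`-algebra `S` generated by
`R`, and `T² = -1` then forces `⟪B v, T v⟫ = 0`, a form of Kramers degeneracy that needs no
eigenvectors: `T v` is orthogonal to the cyclic subspace `[S v]`. Since moreover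
`⟪B T v, T v⟫ = ⟪B v, v⟫`, also `v - T v` is orthogonal to `[S (v + T v)]`. So the projections onto
`[S v]` and `[S (v + T v)]`, which both commute with `H`, act on `v` and `T v` like those onto a
coordinate axis and the diagonal of a plane, and do not commute.
-/

namespace Kramers

open ComplexConjugate Module.End

section CyclicSubspace

variable {𝕜 E : Type*} [NontriviallyNormedField 𝕜] [NormedAddCommGroup E] [NormedSpace 𝕜 E]

/-- The closed cyclic subspace `[S v]` generated by a vector `v` under an algebra `S` of bounded
operators. -/
noncomputable def cyclicSubspace (S : Subalgebra 𝕜 (E →L[𝕜] E)) (v : E) : Submodule 𝕜 E :=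
  (S.toSubmodule.map (ContinuousLinearMap.apply 𝕜 E v).toLinearMap).topologicalClosure

instance [CompleteSpace E] (S : Subalgebra 𝕜 (E →L[𝕜] E)) (v : E) :
    CompleteSpace (cyclicSubspace S v) :=
  (Submodule.isClosed_topologicalClosure _).completeSpace_coe

theorem self_mem_cyclicSubspace (S : Subalgebra 𝕜 (E →L[𝕜] E)) (v : E) :
    v ∈ cyclicSubspace S v :=
  Submodule.le_topologicalClosure _ ⟨1, one_mem S, rfl⟩

theorem cyclicSubspace_mem_invtSubmodule {S : Subalgebra 𝕜 (E →L[𝕜] E)} {B : E →L[𝕜] E}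
    (hB : B ∈ S) (v : E) : cyclicSubspace S v ∈ invtSubmodule B.toLinearMap := by
  refine Submodule.topologicalClosure_mem_invtSubmodule ?_
  rintro _ ⟨A, hA, rfl⟩
  exact ⟨B * A, S.mul_mem hB hA, rfl⟩

end CyclicSubspace

section Projection

variable {𝕜 E : Type*} [RCLike 𝕜] [NormedAddCommGroup E] [InnerProductSpace 𝕜 E]

theorem mem_orthogonal_cyclicSubspace_iff {S : Subalgebra 𝕜 (E →L[𝕜] E)} {v w : E} :
    w ∈ (cyclicSubspace S v)ᗮ ↔ ∀ B ∈ S, inner 𝕜 (B v) w = 0 := by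
  rw [cyclicSubspace, Submodule.orthogonal_closure]
  exact Set.forall_mem_image

variable [CompleteSpace E]

theorem commute_starProjection_of_mem_invtSubmodule {K : Submodule 𝕜 E}
    [K.HasOrthogonalProjection] {B : E →L[𝕜] E} (hB : K ∈ invtSubmodule B.toLinearMap)
    (hB' : K ∈ invtSubmodule (star B).toLinearMap) : Commute K.starProjection B := by
  rw [ContinuousLinearMap.IsIdempotentElem.commute_iff K.isIdempotentElem_starProjection,
    Submodule.range_starProjection, Submodule.ker_starProjection]
  exact ⟨hB, ContinuousLinearMap.orthogonal_mem_invtSubmodule hB'⟩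

theorem commute_starProjection_cyclicSubspace {S : StarSubalgebra 𝕜 (E →L[𝕜] E)} {B : E →L[𝕜] E}
    (hB : B ∈ S) (v : E) : Commute (cyclicSubspace S.toSubalgebra v).starProjection B :=
  commute_starProjection_of_mem_invtSubmodule (cyclicSubspace_mem_invtSubmodule hB v)
    (cyclicSubspace_mem_invtSubmodule (star_mem (s := S) hB) v)

end Projection

section Antiunitary

variable {𝕜 E F : Type*} [RCLike 𝕜] [NormedAddCommGroup E] [InnerProductSpace 𝕜 E]
  [NormedAddCommGroup F] [InnerProductSpace 𝕜 F]

theorem inner_map_map_of_antilinear (T : E →ₗᵢ⋆[𝕜] F) (x y : E) :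
    inner 𝕜 (T x) (T y) = inner 𝕜 y x := by
  have hre (u v : E) : RCLike.re (inner 𝕜 (T u) (T v)) = RCLike.re (inner 𝕜 u v) := by
    simp only [re_inner_eq_norm_add_mul_self_sub_norm_mul_self_sub_norm_mul_self_div_two,
      ← map_add, T.norm_map]
  have him : RCLike.im (inner 𝕜 (T x) (T y)) = -RCLike.im (inner 𝕜 x y) := by
    have h := hre x ((RCLike.I : 𝕜) • y)
    rwa [T.map_smulₛₗ, RCLike.conj_I, neg_smul, inner_neg_right, inner_smul_right,
      inner_smul_right, map_neg, RCLike.I_mul_re, RCLike.I_mul_re, neg_neg] at h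
  refine RCLike.ext ?_ ?_
  · rw [hre, inner_re_symm]
  · rw [him, inner_im_symm, neg_neg]

variable [CompleteSpace E] {T : E ≃ₗᵢ⋆[𝕜] E} {A B : E →L[𝕜] E} {S : StarSubalgebra 𝕜 (E →L[𝕜] E)}

/-- The antiunitary operator `T` intertwines the bounded operator `B` with its adjoint. This, rather
than commutation with `T`, is what complex-valued functions of a self-adjoint operator commuting
with `T` satisfy. -/
def IntertwinesStar (T : E ≃ₗᵢ⋆[𝕜] E) (B : E →L[𝕜] E) : Prop :=
  ∀ x, T (B x) = star B (T x)

namespace IntertwinesStar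

protected theorem star (hB : IntertwinesStar T B) : IntertwinesStar T (star B) := by
  intro x
  rw [star_star]
  refine ext_inner_right 𝕜 fun y => ?_
  obtain ⟨y, rfl⟩ := T.surjective y
  calc inner 𝕜 (T (star B x)) (T y)
    _ = inner 𝕜 y (star B x) := inner_map_map_of_antilinear T.toLinearIsometry _ _
    _ = inner 𝕜 (B y) x := B.adjoint_inner_right y x
    _ = inner 𝕜 (T x) (T (B y)) := (inner_map_map_of_antilinear T.toLinearIsometry _ _).symm
    _ = inner 𝕜 (B (T x)) (T y) := by
      rw [hB, ContinuousLinearMap.star_eq_adjoint, B.adjoint_inner_right]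

theorem mul (hA : IntertwinesStar T A) (hB : IntertwinesStar T B) (hAB : Commute A B) :
    IntertwinesStar T (A * B) := by
  intro x
  calc T (A (B x))
    _ = star A (star B (T x)) := by rw [hA, hB]
    _ = star (B * A) (T x) := by rw [star_mul, mul_apply_eq_comp]
    _ = star (A * B) (T x) := by rw [hAB.eq]

theorem of_mem_adjoin {s : Set (E →L[𝕜] E)} [IsMulCommutative (StarAlgebra.adjoin 𝕜 s)]
    (hs : ∀ A ∈ s, IntertwinesStar T A) (hB : B ∈ StarAlgebra.adjoin 𝕜 s) :
    IntertwinesStar T B := by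
  induction hB using StarAlgebra.adjoin_induction with
  | mem A hA => exact hs A hA
  | algebraMap r =>
    intro x
    rw [← algebraMap_star_comm]
    simp [Algebra.algebraMap_eq_smul_one, T.map_smulₛₗ]
  | add A B _ _ hA hB =>
    intro x
    simp [star_add, hA x, hB x]
  | mul A B hAS hBS hA hB => exact hA.mul hB (setLike_mul_comm hAS hBS)
  | star A _ hA => exact hA.star

theorem inner_apply_map_eq_zero (hB : IntertwinesStar T B) (hT : ∀ x, T (T x) = -x) (v : E) :
    inner 𝕜 (B v) (T v) = 0 := by
  refine self_eq_neg.mp ?_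
  calc inner 𝕜 (B v) (T v)
    _ = inner 𝕜 (T (T v)) (T (B v)) := (inner_map_map_of_antilinear T.toLinearIsometry _ _).symm
    _ = -inner 𝕜 v (star B (T v)) := by rw [hT, hB, inner_neg_left]
    _ = -inner 𝕜 (B v) (T v) := congrArg Neg.neg (B.adjoint_inner_right v (T v))

theorem inner_apply_map_map (hB : IntertwinesStar T B) (v : E) :
    inner 𝕜 (B (T v)) (T v) = inner 𝕜 (B v) v := by
  calc inner 𝕜 (B (T v)) (T v)
    _ = inner 𝕜 (T (star B v)) (T v) := by rw [(IntertwinesStar.star hB) v, star_star]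
    _ = inner 𝕜 v (star B v) := inner_map_map_of_antilinear T.toLinearIsometry _ _
    _ = inner 𝕜 (B v) v := B.adjoint_inner_right v v

end IntertwinesStar

theorem map_mem_orthogonal_cyclicSubspace (hT : ∀ x, T (T x) = -x)
    (hTS : ∀ B ∈ S, IntertwinesStar T B) (v : E) : T v ∈ (cyclicSubspace S.toSubalgebra v)ᗮ :=
  mem_orthogonal_cyclicSubspace_iff.mpr fun B hB => (hTS B hB).inner_apply_map_eq_zero hT v

theorem sub_map_mem_orthogonal_cyclicSubspace_add_map (hT : ∀ x, T (T x) = -x)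
    (hTS : ∀ B ∈ S, IntertwinesStar T B) (v : E) :
    v - T v ∈ (cyclicSubspace S.toSubalgebra (v + T v))ᗮ := by
  refine mem_orthogonal_cyclicSubspace_iff.mpr fun B hB => ?_
  have hv : inner 𝕜 (B v) (T v) = 0 := (hTS B hB).inner_apply_map_eq_zero hT v
  have hTv : inner 𝕜 (B (T v)) v = 0 := by
    simpa [hT] using (hTS B hB).inner_apply_map_eq_zero hT (T v)
  rw [map_add, inner_add_left, inner_sub_right, inner_sub_right, hv, hTv,
    (hTS B hB).inner_apply_map_map, sub_zero, zero_sub, add_neg_cancel]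

theorem not_commute_starProjection_cyclicSubspace (hT : ∀ x, T (T x) = -x)
    (hTS : ∀ B ∈ S, IntertwinesStar T B) {v : E} (hv : v ≠ 0) :
    ¬ Commute (cyclicSubspace S.toSubalgebra v).starProjection
      (cyclicSubspace S.toSubalgebra (v + T v)).starProjection := by
  set K := cyclicSubspace S.toSubalgebra v
  set L := cyclicSubspace S.toSubalgebra (v + T v)
  intro hcomm
  have hvK : v ∈ K := self_mem_cyclicSubspace _ v
  have hTvK : T v ∈ Kᗮ := map_mem_orthogonal_cyclicSubspace hT hTS v
  have hK : K.starProjection (v + T v) = v := by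
    rw [map_add, K.starProjection_eq_self_iff.mpr hvK,
      K.starProjection_apply_eq_zero_iff.mpr hTvK, add_zero]
  have hL : L.starProjection (v + T v) = v + T v :=
    L.starProjection_eq_self_iff.mpr (self_mem_cyclicSubspace _ _)
  have hvL : v ∈ L := by
    rw [← L.starProjection_eq_self_iff]
    calc L.starProjection v
      _ = L.starProjection (K.starProjection (v + T v)) := by rw [hK]
      _ = K.starProjection (L.starProjection (v + T v)) := (DFunLike.congr_fun hcomm _).symm
      _ = v := by rw [hL, hK]
  have hzero : inner 𝕜 v (v - T v) = 0 :=
    sub_map_mem_orthogonal_cyclicSubspace_add_map hT hTS v v hvL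
  rw [inner_sub_right, hTvK v hvK, sub_zero, inner_self_eq_zero] at hzero
  exact hv hzero

end Antiunitary

section Resolvent

variable {𝕜 E : Type*} [NontriviallyNormedField 𝕜] [NormedAddCommGroup E] [NormedSpace 𝕜 E]

/-- `R` is the resolvent of the partially defined operator `A` at `z`: a bounded two-sided inverse
of `A - z`. -/
structure IsResolvent (A : E →ₗ.[𝕜] E) (z : 𝕜) (R : E →L[𝕜] E) : Prop where
  mem_domain (y : E) : R y ∈ A.domain
  sub_smul_apply (y : E) : A ⟨R y, mem_domain y⟩ - z • R y = y
  apply_sub_smul (x : A.domain) : R (A x - z • (x : E)) = x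

/-- The operator `A - z`, transported to the graph of `A`: unlike the domain of `A`, the graph is
complete if `A` is closed, and `A - z` is bounded on it. -/
def graphShift (A : E →ₗ.[𝕜] E) (z : 𝕜) : A.graph →L[𝕜] E :=
  (ContinuousLinearMap.snd 𝕜 E E - z • ContinuousLinearMap.fst 𝕜 E E).comp A.graph.subtypeL

theorem graphShift_apply (A : E →ₗ.[𝕜] E) (z : 𝕜) (x : A.domain) :
    graphShift A z ⟨(x, A x), A.mem_graph x⟩ = A x - z • (x : E) :=
  rfl

theorem exists_isResolvent_of_bijective_graphShift [CompleteSpace E] {A : E →ₗ.[𝕜] E}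
    (hA : A.IsClosed) {z : 𝕜} (hz : Function.Bijective (graphShift A z)) :
    ∃ R, IsResolvent A z R := by
  have : CompleteSpace A.graph := hA.completeSpace_coe
  let e : A.graph ≃L[𝕜] E := .ofBijective (graphShift A z)
    (LinearMap.ker_eq_bot.mpr hz.injective) (LinearMap.range_eq_top.mpr hz.surjective)
  let R : E →L[𝕜] E :=
    (ContinuousLinearMap.fst 𝕜 E E).comp (A.graph.subtypeL.comp e.symm.toContinuousLinearMap)
  have apply_sub_smul (x : A.domain) : R (A x - z • (x : E)) = x :=
    congrArg (fun p : A.graph => p.1.1) (e.symm_apply_apply ⟨(x, A x), A.mem_graph x⟩)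
  have exists_domain (y : E) : ∃ x : A.domain, R y = x ∧ A x - z • (x : E) = y := by
    obtain ⟨⟨⟨_, _⟩, hp⟩, rfl⟩ := hz.surjective y
    obtain ⟨x, rfl, rfl⟩ := A.mem_graph_iff.mp hp
    exact ⟨x, apply_sub_smul x, rfl⟩
  have mem_domain (y : E) : R y ∈ A.domain := by
    obtain ⟨x, hx, -⟩ := exists_domain y
    exact hx ▸ x.2
  refine ⟨R, mem_domain, fun y => ?_, apply_sub_smul⟩
  obtain ⟨x, hx, hxy⟩ := exists_domain y
  rwa [show (⟨R y, mem_domain y⟩ : A.domain) = x from Subtype.ext hx, hx]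

theorem exists_antilipschitzWith_graphShift {A : E →ₗ.[𝕜] E} {z : 𝕜} {c : ℝ} (hc : 0 < c)
    (h : ∀ x : A.domain, c * ‖(x : E)‖ ≤ ‖A x - z • (x : E)‖) :
    ∃ K, AntilipschitzWith K (graphShift A z) := by
  refine ⟨⟨c⁻¹ + (1 + ‖z‖ * c⁻¹), by positivity⟩,
    AddMonoidHomClass.antilipschitz_of_bound _ fun p => ?_⟩
  obtain ⟨⟨_, _⟩, hp⟩ := p
  obtain ⟨x, rfl, rfl⟩ := A.mem_graph_iff.mp hp
  rw [graphShift_apply]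
  set y := A x - z • (x : E)
  have hx : ‖(x : E)‖ ≤ c⁻¹ * ‖y‖ := (le_inv_mul_iff₀ hc).mpr (h x)
  have hAx : ‖A x‖ ≤ (1 + ‖z‖ * c⁻¹) * ‖y‖ :=
    calc ‖A x‖
      _ = ‖y + z • (x : E)‖ := by rw [sub_add_cancel]
      _ ≤ ‖y‖ + ‖z‖ * ‖(x : E)‖ := (norm_add_le _ _).trans_eq (by rw [norm_smul])
      _ ≤ ‖y‖ + ‖z‖ * (c⁻¹ * ‖y‖) := by gcongr
      _ = (1 + ‖z‖ * c⁻¹) * ‖y‖ := by ring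
  calc ‖((x : E), A x)‖
    _ ≤ ‖(x : E)‖ + ‖A x‖ := max_le_add_of_nonneg (norm_nonneg _) (norm_nonneg _)
    _ ≤ (c⁻¹ + (1 + ‖z‖ * c⁻¹)) * ‖y‖ := by rw [add_mul]; gcongr

end Resolvent

section SelfAdjoint

variable {𝕜 E : Type*} [RCLike 𝕜] [NormedAddCommGroup E] [InnerProductSpace 𝕜 E]

theorem abs_im_mul_norm_le_norm_sub_smul {A : E →ₗ.[𝕜] E} (hA : A.IsFormalAdjoint A) (z : 𝕜)
    (x : A.domain) : |RCLike.im z| * ‖(x : E)‖ ≤ ‖A x - z • (x : E)‖ := by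
  have him : RCLike.im (inner 𝕜 (x : E) (A x)) = 0 := by
    rw [← RCLike.conj_eq_iff_im, inner_conj_symm]
    exact hA x x
  have hinner : RCLike.im (inner 𝕜 (x : E) (A x - z • (x : E))) =
      -(RCLike.im z * (‖(x : E)‖ * ‖(x : E)‖)) := by
    rw [inner_sub_right, inner_smul_right, map_sub, him, RCLike.mul_im, inner_self_im,
      inner_self_eq_norm_mul_norm, mul_zero, zero_add, zero_sub]
  rcases (norm_nonneg (x : E)).eq_or_lt with hx | hx
  · simp [← hx]
  refine le_of_mul_le_mul_left ?_ hx
  calc ‖(x : E)‖ * (|RCLike.im z| * ‖(x : E)‖)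
    _ = |RCLike.im (inner 𝕜 (x : E) (A x - z • (x : E)))| := by
      rw [hinner, abs_neg, abs_mul, abs_mul_self, mul_left_comm]
    _ ≤ ‖inner 𝕜 (x : E) (A x - z • (x : E))‖ := RCLike.abs_im_le_norm _
    _ ≤ ‖(x : E)‖ * ‖A x - z • (x : E)‖ := norm_inner_le_norm _ _

variable [CompleteSpace E] {A : E →ₗ.[𝕜] E} {z : 𝕜} {R R' : E →L[𝕜] E}

theorem isFormalAdjoint_of_isSelfAdjoint (hA : IsSelfAdjoint A) : A.IsFormalAdjoint A := by
  simpa only [LinearPMap.isSelfAdjoint_def.mp hA] using A.adjoint_isFormalAdjoint hA.dense_domain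

theorem IsResolvent.star_eq (hA : A.IsFormalAdjoint A) (hR : IsResolvent A z R)
    (hR' : IsResolvent A (conj z) R') : star R = R' := by
  rw [ContinuousLinearMap.star_eq_adjoint, eq_comm, ContinuousLinearMap.eq_adjoint_iff]
  intro x y
  calc inner 𝕜 (R' x) y
    _ = inner 𝕜 (R' x) (A ⟨R y, hR.mem_domain y⟩ - z • R y) := by rw [hR.sub_smul_apply]
    _ = inner 𝕜 (A ⟨R' x, hR'.mem_domain x⟩ - conj z • R' x) (R y) := by
      rw [inner_sub_left, inner_sub_right, inner_smul_left, inner_smul_right, RCLike.conj_conj]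
      exact congrArg (· - _) (hA ⟨R' x, hR'.mem_domain x⟩ ⟨R y, hR.mem_domain y⟩).symm
    _ = inner 𝕜 x (R y) := by rw [hR'.sub_smul_apply]

theorem mem_graph_of_mem_orthogonal_range_graphShift (hA : IsSelfAdjoint A) {y : E}
    (hy : y ∈ (graphShift A z).rangeᗮ) : (y, conj z • y) ∈ A.graph := by
  have hadj (x : A.domain) : inner 𝕜 (conj z • y) (x : E) = inner 𝕜 y (A x) := by
    have h : inner 𝕜 y (A x - z • (x : E)) = 0 := Submodule.inner_left_of_mem_orthogonal
      (LinearMap.mem_range_self (graphShift A z).toLinearMap ⟨(x, A x), A.mem_graph x⟩) hy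
    rw [inner_sub_right, sub_eq_zero, inner_smul_right] at h
    rw [inner_smul_left, RCLike.conj_conj, h]
  have hmem : y ∈ A.adjoint.domain := A.mem_adjoint_domain_of_exists y ⟨_, hadj⟩
  rw [← LinearPMap.isSelfAdjoint_def.mp hA]
  exact A.adjoint.mem_graph_iff.mpr ⟨⟨y, hmem⟩, rfl, A.adjoint_apply_eq hA.dense_domain _ hadj⟩

theorem orthogonal_range_graphShift_eq_bot (hA : IsSelfAdjoint A) (hz : RCLike.im z ≠ 0) :
    (graphShift A z).rangeᗮ = ⊥ := by
  rw [Submodule.eq_bot_iff]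
  intro y hy
  obtain ⟨x, hx, hAx⟩ := A.mem_graph_iff.mp (mem_graph_of_mem_orthogonal_range_graphShift hA hy)
  have h := abs_im_mul_norm_le_norm_sub_smul (isFormalAdjoint_of_isSelfAdjoint hA) (conj z) x
  rw [hx, hAx, sub_self, norm_zero, RCLike.conj_im, abs_neg] at h
  exact norm_le_zero_iff.mp (nonpos_of_mul_nonpos_right h (abs_pos.mpr hz))

theorem exists_isResolvent_of_isSelfAdjoint (hA : IsSelfAdjoint A) (hz : RCLike.im z ≠ 0) :
    ∃ R, IsResolvent A z R := by
  have : CompleteSpace A.graph := hA.isClosed.completeSpace_coe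
  obtain ⟨K, hK⟩ := exists_antilipschitzWith_graphShift (abs_pos.mpr hz)
    (abs_im_mul_norm_le_norm_sub_smul (isFormalAdjoint_of_isSelfAdjoint hA) z)
  have hclosed : IsClosed ((graphShift A z).range : Set E) :=
    hK.isClosed_range (graphShift A z).uniformContinuous
  have : CompleteSpace (graphShift A z).range := hclosed.completeSpace_coe
  have hrange : (graphShift A z).range = ⊤ :=
    Submodule.orthogonal_eq_bot_iff.mp (orthogonal_range_graphShift_eq_bot hA hz)
  exact exists_isResolvent_of_bijective_graphShift hA.isClosed
    ⟨hK.injective, LinearMap.range_eq_top.mp hrange⟩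

end SelfAdjoint

section Commutant

variable {E : Type*} [NormedAddCommGroup E] [InnerProductSpace ℂ E]
  {A : E →ₗ.[ℂ] E} {z w : ℂ} {R R' B C : E →L[ℂ] E}

theorem IsResolvent.commutesWith_iff {σ : ℂ →+* ℂ} {F : Type*} [FunLike F E E]
    [SemilinearMapClass F σ E E] {T : F} (hR : IsResolvent A z R)
    (hR' : IsResolvent A (σ z) R') : CommutesWith T A ↔ ∀ y, T (R y) = R' (T y) := by
  constructor
  · intro hT y
    obtain ⟨hmem, hA⟩ := hT ⟨R y, hR.mem_domain y⟩
    calc T (R y)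
      _ = R' (A ⟨T (R y), hmem⟩ - σ z • T (R y)) := (hR'.apply_sub_smul ⟨T (R y), hmem⟩).symm
      _ = R' (T y) := by rw [hA, ← map_smulₛₗ, ← map_sub, hR.sub_smul_apply]
  · intro hT x
    have hTx : T x = R' (T (A x - z • (x : E))) := by rw [← hT, hR.apply_sub_smul]
    have hmem : T x ∈ A.domain := hTx ▸ hR'.mem_domain _
    have hA : A ⟨T x, hmem⟩ - σ z • T x = T (A x - z • (x : E)) := by
      simpa only [← hTx] using hR'.sub_smul_apply (T (A x - z • (x : E)))
    rw [map_sub, map_smulₛₗ, sub_left_inj] at hA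
    exact ⟨hmem, hA⟩

theorem IsResolvent.mem_commutant_iff (hR : IsResolvent A z R) :
    B ∈ commutant A ↔ Commute B R :=
  (hR.commutesWith_iff (σ := RingHom.id ℂ) (T := B) hR).trans
    ⟨fun h => ContinuousLinearMap.ext h, fun h => DFunLike.congr_fun h⟩

theorem IsResolvent.mem_commutant (hR : IsResolvent A z R) : R ∈ commutant A :=
  hR.mem_commutant_iff.mpr (Commute.refl R)

theorem IsResolvent.commute (hR : IsResolvent A z R) (hR' : IsResolvent A w R') : Commute R R' :=
  hR'.mem_commutant_iff.mp hR.mem_commutant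

theorem commute_of_mem_boundedDoubleCommutant (hC : C ∈ boundedDoubleCommutant A)
    (hB : B ∈ commutant A) : Commute C B :=
  ContinuousLinearMap.ext fun x => (hC.2.2 B hB ⟨x, trivial⟩).2

variable [CompleteSpace E]

theorem exists_mem_commutant_not_commute [Nontrivial E] (hA : IsSelfAdjoint A)
    {T : E ≃ₗᵢ⋆[ℂ] E} (hT : ∀ x, T (T x) = -x) (hTA : CommutesWith T A) :
    ∃ P ∈ commutant A, ∃ Q ∈ commutant A, ¬ Commute P Q := by
  obtain ⟨R, hR⟩ := exists_isResolvent_of_isSelfAdjoint hA (z := Complex.I) (by simp)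
  obtain ⟨R', hR'⟩ := exists_isResolvent_of_isSelfAdjoint hA (z := conj Complex.I) (by simp)
  obtain rfl : star R = R' := hR.star_eq (isFormalAdjoint_of_isSelfAdjoint hA) hR'
  have : IsStarNormal R := ⟨hR'.commute hR⟩
  have hTR : IntertwinesStar T R := (hR.commutesWith_iff hR').mp hTA
  have hTS : ∀ B ∈ StarAlgebra.adjoin ℂ {R}, IntertwinesStar T B := fun B hB =>
    .of_mem_adjoin (by simpa using hTR) hB
  have hproj (v : E) : (cyclicSubspace (StarAlgebra.adjoin ℂ {R}).toSubalgebra v).starProjection ∈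
      commutant A := hR.mem_commutant_iff.mpr
    (commute_starProjection_cyclicSubspace (StarAlgebra.self_mem_adjoin_singleton ℂ R) v)
  obtain ⟨v, hv⟩ := exists_ne (0 : E)
  exact ⟨_, hproj v, _, hproj (v + T v), not_commute_starProjection_cyclicSubspace hT hTS hv⟩

end Commutant

theorem nontrivial_of_linearPMap_ne_zero {R E F : Type*} [Ring R] [AddCommGroup E] [Module R E]
    [AddCommGroup F] [Module R F] {A : E →ₗ.[R] F} (hA : A ≠ 0) : Nontrivial E := by
  contrapose! hA
  refine LinearPMap.ext (Subsingleton.elim _ _) fun x hx hx' => ?_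
  obtain rfl : x = 0 := Subsingleton.elim _ _
  exact A.map_zero.trans (LinearPMap.map_zero 0).symm

end Kramers

theorem mainTheorem1_general {E : Type*} [NormedAddCommGroup E] [InnerProductSpace ℂ E]
    [CompleteSpace E] [Nontrivial E] (H : E →ₗ.[ℂ] E) (hH : IsSelfAdjoint H)
    (T : E ≃ₗᵢ⋆[ℂ] E) (hT : ∀ x, T (T x) = -x) (hTH : Kramers.CommutesWith T H) :
    Kramers.ofBounded '' Kramers.commutant H ≠ Kramers.doubleCommutant H ∧
      Kramers.commutant H ≠ Kramers.boundedDoubleCommutant H := by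
  obtain ⟨P, hP, Q, hQ, hPQ⟩ := Kramers.exists_mem_commutant_not_commute hH hT hTH
  have hP' : Kramers.ofBounded P ∉ Kramers.doubleCommutant H := fun h =>
    hPQ (Kramers.commute_of_mem_boundedDoubleCommutant h hQ)
  exact ⟨fun h => hP' (h ▸ Set.mem_image_of_mem _ hP), fun h => hP' (h ▸ hP :)⟩

theorem mainTheorem1 {E : Type*} [NormedAddCommGroup E] [InnerProductSpace ℂ E]
    [CompleteSpace E] [TopologicalSpace.SeparableSpace E]
    (H : E →ₗ.[ℂ] E) (hH : IsSelfAdjoint H) (hH0 : H ≠ 0)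
    (T : E ≃ₗᵢ⋆[ℂ] E) (hT : ∀ x, T (T x) = -x) (hTH : Kramers.CommutesWith T H) :
    Kramers.ofBounded '' Kramers.commutant H ≠ Kramers.doubleCommutant H ∧
      Kramers.commutant H ≠ Kramers.boundedDoubleCommutant H := by
  have := Kramers.nontrivial_of_linearPMap_ne_zero hH0
  exact mainTheorem1_general H hH T hT hTH
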